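/- Let $G$ be a finite simple undirected graph with $n$ vertices and maximum degree $\Delta\ge 1$. For an integer $B$ with $0\le B\le n$, let $S$ be a set of $B$ vertices drawn uniformly at random without replacement, and let $L_B$ be the number of vertices of a largest connected component of the subgraph of $G$ induced by $S$. 1. For every $\varepsilon_0<1$ and every $k\in\mathbb N$ there is a constant $C=C(\varepsilon_0,k)>0$ such that for all such $G$ and all $0<\varepsilon\le\varepsilon_0$: if $B$ is a non-negative integer with $|B-\varepsilon n/\Delta|<1$ (that is, $B$ is $\varepsilon n/\Delta$, rounded up or down if it is not an integer), then $$\Pr\Big[L_B> C\,\frac{\log n}{\varepsilon^2}\Big]\le n^{-k}.$$ 2. For every $k\in\mathbb N$ there is a constant $C=C(k)>0$ such that for all such $G$ and all $0<\varepsilon<1$: if $B$ is a non-negative integer with $|B-(1-\varepsilon)n/\Delta|<1$, then $$\Pr\Big[L_B> C\,\frac{\log n}{\varepsilon^2}\Big]\le n^{-k}.$$ -/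

import Mathlib

namespace SubgraphSampling

/-- The number of vertices of a largest connected component of a finite graph
(`0` for the graph without vertices). -/
noncomputable def largestComponentSize {W : Type*} [Finite W] (H : SimpleGraph W) : ℕ :=
  ⨆ c : H.ConnectedComponent, c.supp.ncard

open Classical in
/-- The probability that `E S` holds, where `S` is a uniformly random subset of `V` with exactly
`B` elements, that is, `B` elements of `V` drawn uniformly without replacement.
It is meaningful for `B ≤ Fintype.card V`. -/
noncomputable def sampleProb (V : Type*) [Fintype V] (B : ℕ) (E : Finset V → Prop) : ℝ :=
  (((Finset.univ : Finset V).powersetCard B).filter E).card /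
    ((Finset.univ : Finset V).powersetCard B).card

/-- The size of a largest connected component of the subgraph of `G` induced by `S`. -/
noncomputable def sampledComponentSize {V : Type*} (G : SimpleGraph V) (S : Finset V) : ℕ :=
  largestComponentSize (G.induce (S : Set V))

end SubgraphSampling

namespace SubgraphSampling

open Finset

/-! Independent sampling at density p = B/n yields a set of size B with probability at least 1/(n +
1), so it suffices to bound independent sampling and lose a factor n + 1.

There, the cluster of a sampled vertex v equals K exactly when K is kept and its outer boundary is
not, which has probability p^a (1 - p)^b with a = |K| and b the boundary size. For a > 1 every
vertex of K spends an edge inside K, so b ≤ (Δ - 1) a. Comparing p with the density q = 1/Δ and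
writing η = 1 - pΔ, the linear terms in η cancel and the ratio of the two probabilities is at most
exp(-η² a / 2). The cluster probabilities at density q sum to at most 1, so the cluster of v exceeds
t with probability at most exp(-η² t / 2), with no enumeration of clusters
(`sum_bernoulliWeight_cluster_le`). A union bound over v finishes, up to rounding of B. -/

/-! ### The mode of the binomial distribution -/

/-- Among the terms of the expansion of `(B + (n - B)) ^ n` the one with index `B` is largest. -/
theorem binomial_term_le_mode {n B : ℕ} (hB : B ≤ n) {j : ℕ} (hj : j ≤ n) :
    B ^ j * (n - B) ^ (n - j) * n.choose j ≤ B ^ B * (n - B) ^ (n - B) * n.choose B := by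
  -- Ratio of consecutive terms, cross-multiplied to stay in ℕ.
  have step : ∀ i, i < n → (B ^ (i + 1) * (n - B) ^ (n - (i + 1)) * n.choose (i + 1)) *
      ((i + 1) * (n - B)) = (B ^ i * (n - B) ^ (n - i) * n.choose i) * (B * (n - i)) := by
    intro i hi
    have h := Nat.choose_succ_right_eq n i
    obtain ⟨m, hm⟩ : ∃ m, n - i = m + 1 := ⟨n - i - 1, by omega⟩
    have hm' : n - (i + 1) = m := by omega
    rw [hm', hm, pow_succ, pow_succ]
    rw [hm] at h
    calc _ = B ^ i * B * (n - B) ^ m * (n - B) * (n.choose (i + 1) * (i + 1)) := by ring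
      _ = _ := by rw [h]; ring
  rcases le_total j B with hjB | hjB
  · induction hjB using Nat.decreasingInduction with
    | self => exact le_rfl
    | of_succ i hi ih =>
      refine le_trans ?_ (ih (by omega))
      have hpos : 0 < B * (n - i) := Nat.mul_pos (by omega) (by omega)
      refine Nat.le_of_mul_le_mul_right ?_ hpos
      rw [← step i (by omega)]
      refine Nat.mul_le_mul_left _ ?_
      obtain ⟨c, rfl⟩ := Nat.exists_eq_add_of_le hB
      obtain ⟨d, rfl⟩ := Nat.exists_eq_add_of_lt hi
      have h1 : i + d + 1 + c - (i + d + 1) = c := by omega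
      have h2 : i + d + 1 + c - i = d + 1 + c := by omega
      rw [h1, h2]
      nlinarith [Nat.zero_le (i * d), Nat.zero_le (d * c), Nat.zero_le (d * d), Nat.zero_le i]
  · induction j, hjB using Nat.le_induction with
    | base => exact le_rfl
    | succ i hi ih =>
      rcases Nat.eq_or_lt_of_le hB with h | h
      · omega
      refine le_trans ?_ (ih (by omega))
      have hpos : 0 < (i + 1) * (n - B) := Nat.mul_pos (by omega) (by omega)
      refine Nat.le_of_mul_le_mul_right ?_ hpos
      rw [step i (by omega)]
      refine Nat.mul_le_mul_left _ ?_
      exact Nat.mul_le_mul (by omega) (by omega)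

/-- The n + 1 binomial probabilities sum to 1, and the one at the mode B is at least their average.
-/
theorem one_le_succ_mul_mode {n B : ℕ} (hB : B ≤ n) (hn : 0 < n) :
    1 ≤ ((n : ℝ) + 1) *
      (((B : ℝ) / n) ^ B * (1 - (B : ℝ) / n) ^ (n - B) * (n.choose B : ℝ)) := by
  have h1 : n ^ n ≤ (n + 1) * (B ^ B * (n - B) ^ (n - B) * n.choose B) := by
    calc n ^ n = (B + (n - B)) ^ n := by rw [Nat.add_sub_cancel' hB]
      _ = ∑ j ∈ range (n + 1), B ^ j * (n - B) ^ (n - j) * n.choose j := add_pow _ _ _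
      _ ≤ ∑ j ∈ range (n + 1), B ^ B * (n - B) ^ (n - B) * n.choose B :=
          sum_le_sum fun j hj => binomial_term_le_mode hB (by simpa [Nat.lt_succ_iff] using hj)
      _ = _ := by simp
  have h2 : (n : ℝ) ^ n ≤
      (n + 1) * ((B : ℝ) ^ B * ((n : ℝ) - B) ^ (n - B) * (n.choose B : ℝ)) := by
    have := (Nat.cast_le (α := ℝ)).2 h1
    push_cast [Nat.cast_sub hB] at this
    exact this
  have hn' : (0 : ℝ) < n := by exact_mod_cast hn
  have h3 : 1 - (B : ℝ) / n = ((n : ℝ) - B) / n := by field_simp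
  have h4 : (n : ℝ) ^ n = (n : ℝ) ^ B * (n : ℝ) ^ (n - B) := by
    rw [← pow_add, Nat.add_sub_cancel' hB]
  rw [h3, div_pow, div_pow]
  have h5 : ((n : ℝ) + 1) * ((B : ℝ) ^ B / (n : ℝ) ^ B *
      (((n : ℝ) - B) ^ (n - B) / (n : ℝ) ^ (n - B)) * (n.choose B : ℝ)) =
      ((n + 1) * ((B : ℝ) ^ B * ((n : ℝ) - B) ^ (n - B) * (n.choose B : ℝ))) / (n : ℝ) ^ n := by
    rw [h4]
    field_simp
  rw [h5, one_le_div (by positivity)]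
  exact h2

/-! ### Independent sampling -/

variable {V : Type*} [Fintype V]

/-- The probability of the set `S` when every vertex is kept independently with probability `p`. -/
noncomputable def bernoulliWeight (p : ℝ) (S : Finset V) : ℝ :=
  p ^ #S * (1 - p) ^ (Fintype.card V - #S)

theorem bernoulliWeight_nonneg {p : ℝ} (hp : 0 ≤ p) (hp1 : p ≤ 1) (S : Finset V) :
    0 ≤ bernoulliWeight p S :=
  mul_nonneg (pow_nonneg hp _) (pow_nonneg (by linarith) _)

theorem sum_bernoulliWeight (p : ℝ) : ∑ S : Finset V, bernoulliWeight p S = 1 := by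
  simp only [bernoulliWeight]
  rw [Fintype.sum_pow_mul_eq_add_pow]
  simp

-- The vertices outside D are unconstrained, and their weights sum to 1.
open Classical in
theorem sum_bernoulliWeight_cylinder (p : ℝ) {D K : Finset V} (hKD : K ⊆ D) :
    ∑ S : Finset V with S ∩ D = K, bernoulliWeight p S = p ^ #K * (1 - p) ^ #(D \ K) := by
  have h1 : ∑ S : Finset V with S ∩ D = K, bernoulliWeight p S =
      ∑ T ∈ (Dᶜ).powerset, (p ^ #K * (1 - p) ^ #(D \ K)) *
        (p ^ #T * (1 - p) ^ (#Dᶜ - #T)) := by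
    refine sum_nbij' (fun S => S \ D) (fun T => T ∪ K) ?_ ?_ ?_ ?_ ?_
    · intro S _
      simp only [mem_powerset]
      intro x hx
      simp only [mem_sdiff, mem_compl] at hx ⊢
      exact hx.2
    · intro T hT
      simp only [mem_powerset] at hT
      simp only [mem_filter, mem_univ, true_and]
      ext x
      have := @hT x
      have := @hKD x
      simp only [mem_compl, mem_inter, mem_union] at *
      tauto
    · intro S hS
      simp only [mem_filter, mem_univ, true_and] at hS
      subst hS
      exact sdiff_union_inter S D
    · intro T hT
      simp only [mem_powerset] at hT
      ext x
      have := @hT x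
      have := @hKD x
      simp only [mem_compl, mem_sdiff, mem_union] at *
      tauto
    · intro S hS
      simp only [mem_filter, mem_univ, true_and] at hS
      have e1 : #S = #K + #(S \ D) := by
        rw [← hS, add_comm]; exact (card_sdiff_add_card_inter S D).symm
      have e2 : #(D \ K) + #K = #D := card_sdiff_add_card_eq_card hKD
      have e3 : #D + #Dᶜ = Fintype.card V := card_add_card_compl D
      have e4 : #(S \ D) ≤ #Dᶜ := card_le_card fun x hx => by
        simp only [mem_sdiff, mem_compl] at hx ⊢
        exact hx.2
      have e5 : Fintype.card V - #S = #(D \ K) + (#Dᶜ - #(S \ D)) := by omega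
      rw [bernoulliWeight, e5, e1, pow_add, pow_add]
      ring
  rw [h1, ← mul_sum, sum_pow_mul_eq_add_pow]
  simp

open Classical in
/-- Sampling without replacement is at most `n + 1` times as likely to meet an event as
independent sampling of the same density. -/
theorem sampleProb_le_bernoulli [Nonempty V] {B : ℕ} (hB : B ≤ Fintype.card V)
    (E : Finset V → Prop) :
    sampleProb V B E ≤ ((Fintype.card V : ℝ) + 1) *
      ∑ S : Finset V with E S, bernoulliWeight ((B : ℝ) / Fintype.card V) S := by
  set n := Fintype.card V with hn
  have hn0 : 0 < n := Fintype.card_pos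
  have hn' : (0 : ℝ) < n := by exact_mod_cast hn0
  set p : ℝ := (B : ℝ) / n with hp
  have hp0 : 0 ≤ p := by positivity
  have hp1 : p ≤ 1 := by
    rw [hp, div_le_one hn']; exact_mod_cast hB
  have hc : #((univ : Finset V).powersetCard B) = n.choose B := by
    rw [card_powersetCard, card_univ]
  have hch : (0 : ℝ) < n.choose B := by exact_mod_cast Nat.choose_pos hB
  set A := ((univ : Finset V).powersetCard B).filter E with hA
  have h1 : (#A : ℝ) * (p ^ B * (1 - p) ^ (n - B)) ≤
      ∑ S : Finset V with E S, bernoulliWeight p S := by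
    calc (#A : ℝ) * (p ^ B * (1 - p) ^ (n - B)) = ∑ S ∈ A, bernoulliWeight p S := by
          rw [← nsmul_eq_mul, ← sum_const]
          refine sum_congr rfl fun S hS => ?_
          rw [hA, mem_filter, mem_powersetCard] at hS
          rw [bernoulliWeight, hS.1.2]
      _ ≤ _ := by
          refine sum_le_sum_of_subset_of_nonneg ?_ fun S _ _ => bernoulliWeight_nonneg hp0 hp1 S
          intro S hS
          rw [hA, mem_filter] at hS
          simpa using hS.2
  have hmode := one_le_succ_mul_mode hB hn0
  rw [sampleProb, hc, div_le_iff₀ hch]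
  calc (#A : ℝ) ≤ #A * (((n : ℝ) + 1) * (p ^ B * (1 - p) ^ (n - B) * (n.choose B : ℝ))) :=
        le_mul_of_one_le_right (by positivity) hmode
    _ = (n + 1) * (#A * (p ^ B * (1 - p) ^ (n - B))) * (n.choose B : ℝ) := by ring
    _ ≤ _ := by gcongr

/-! ### Open clusters -/

open Classical in
/-- The vertices that can be reached from `v` by walks all of whose vertices after `v` lie
in `S`. -/
noncomputable def cluster (G : SimpleGraph V) (S : Finset V) (v : V) : Finset V :=
  {u | Relation.ReflTransGen (fun x y => G.Adj x y ∧ y ∈ S) v u}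

theorem mem_cluster {G : SimpleGraph V} {S : Finset V} {v u : V} :
    u ∈ cluster G S v ↔ Relation.ReflTransGen (fun x y => G.Adj x y ∧ y ∈ S) v u := by
  simp [cluster]

theorem self_mem_cluster (G : SimpleGraph V) (S : Finset V) (v : V) : v ∈ cluster G S v :=
  mem_cluster.2 .refl

theorem mem_cluster_of_adj {G : SimpleGraph V} {S : Finset V} {v x y : V}
    (hx : x ∈ cluster G S v) (h : G.Adj x y) (hy : y ∈ S) : y ∈ cluster G S v :=
  mem_cluster.2 ((mem_cluster.1 hx).tail ⟨h, hy⟩)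

theorem cluster_subset {G : SimpleGraph V} {S : Finset V} {v : V} (hv : v ∈ S) :
    cluster G S v ⊆ S := by
  intro u hu
  rcases (mem_cluster.1 hu).cases_tail with h | ⟨_, _, h⟩
  · exact h ▸ hv
  · exact h.2

open Classical in
/-- A set of vertices together with all its neighbours. -/
noncomputable def closedNeighborhood (G : SimpleGraph V) (K : Finset V) : Finset V :=
  K ∪ univ.filter fun y => ∃ x ∈ K, G.Adj x y

theorem subset_closedNeighborhood (G : SimpleGraph V) (K : Finset V) :
    K ⊆ closedNeighborhood G K := by
  classical exact subset_union_left

theorem mem_closedNeighborhood_of_adj {G : SimpleGraph V} {K : Finset V} {x y : V} (hx : x ∈ K)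
    (h : G.Adj x y) : y ∈ closedNeighborhood G K := by
  classical exact mem_union_right _ (by simpa using ⟨x, hx, h⟩)

open Classical in
theorem inter_closedNeighborhood_cluster {G : SimpleGraph V} {S : Finset V} {v : V} (hv : v ∈ S) :
    S ∩ closedNeighborhood G (cluster G S v) = cluster G S v := by
  refine Subset.antisymm ?_
    (subset_inter (cluster_subset hv) (subset_closedNeighborhood G _))
  intro y hy
  rw [mem_inter, closedNeighborhood, mem_union] at hy
  rcases hy.2 with h | h
  · exact h
  · simp only [mem_filter, mem_univ, true_and] at h
    obtain ⟨x, hx, hxy⟩ := h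
    exact mem_cluster_of_adj hx hxy hy.1

open Classical in
/-- Two samples that agree on the closed neighbourhood of the cluster of `v` in one of them have
the same cluster of `v`. -/
theorem cluster_eq_of_inter_eq {G : SimpleGraph V} {S T : Finset V} {v : V}
    (h : T ∩ closedNeighborhood G (cluster G S v) = cluster G S v) :
    cluster G T v = cluster G S v := by
  refine Subset.antisymm ?_ ?_
  · intro u hu
    have hu := mem_cluster.1 hu
    induction hu with
    | refl => exact self_mem_cluster G S v
    | tail _ hxy ih =>
      rw [← h, mem_inter]
      exact ⟨hxy.2, mem_closedNeighborhood_of_adj (ih (mem_cluster.2 ‹_›)) hxy.1⟩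
  · intro u hu
    have hu := mem_cluster.1 hu
    induction hu with
    | refl => exact self_mem_cluster G T v
    | tail hvx hxy ih =>
      have hy := mem_cluster.2 (hvx.tail hxy)
      rw [← h, mem_inter] at hy
      exact mem_cluster_of_adj (ih (mem_cluster.2 hvx)) hxy.1 hy.1

-- Turns a prescribed cluster into a cylinder event, whose probability is explicit.
open Classical in
theorem filter_cluster_eq (G : SimpleGraph V) (S : Finset V) (v : V) :
    (univ.filter fun T => v ∈ T ∧ cluster G T v = cluster G S v) =
      univ.filter fun T => T ∩ closedNeighborhood G (cluster G S v) = cluster G S v := by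
  ext T
  simp only [mem_filter, mem_univ, true_and]
  constructor
  · rintro ⟨hvT, h⟩
    rw [← h]
    exact inter_closedNeighborhood_cluster hvT
  · intro h
    refine ⟨?_, cluster_eq_of_inter_eq h⟩
    have := self_mem_cluster G S v
    rw [← h] at this
    exact (mem_inter.1 this).1

theorem exists_adj_mem_cluster {G : SimpleGraph V} {S : Finset V} {v u : V} (hv : v ∈ S)
    (hK : 1 < #(cluster G S v)) (hu : u ∈ cluster G S v) : ∃ x ∈ cluster G S v, G.Adj u x := by
  rcases (mem_cluster.1 hu).cases_tail with h | ⟨x, hx, hxu⟩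
  · subst h
    obtain ⟨w, hw, hwu⟩ := exists_mem_ne hK u
    rcases (mem_cluster.1 hw).cases_head with h | ⟨x, hx, -⟩
    · exact absurd h.symm hwu
    · exact ⟨x, mem_cluster_of_adj hu hx.1 hx.2, hx.1⟩
  · exact ⟨x, mem_cluster.2 hx, hxu.1.symm⟩

-- Each vertex of K has a neighbour in K, hence at most Δ - 1 outside. The saved 1 is what makes the
-- linear terms cancel in `density_comparison`.
open Classical in
theorem card_boundary_le {G : SimpleGraph V} [DecidableRel G.Adj] {K : Finset V}
    (hK : ∀ u ∈ K, ∃ x ∈ K, G.Adj u x) :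
    #(closedNeighborhood G K \ K) ≤ (G.maxDegree - 1) * #K := by
  calc #(closedNeighborhood G K \ K) ≤ #(K.biUnion fun u => G.neighborFinset u \ K) := by
        refine card_le_card fun y hy => ?_
        simp only [closedNeighborhood, mem_sdiff, mem_union, mem_filter, mem_univ, true_and] at hy
        obtain ⟨h | ⟨x, hx, hxy⟩, hyK⟩ := hy
        · exact absurd h hyK
        · simp only [mem_biUnion, mem_sdiff, SimpleGraph.mem_neighborFinset]
          exact ⟨x, hx, hxy, hyK⟩
    _ ≤ #K * (G.maxDegree - 1) := by
        refine card_biUnion_le_card_mul _ _ _ fun u hu => ?_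
        obtain ⟨x, hx, hux⟩ := hK u hu
        have h1 : #(G.neighborFinset u \ K) < #(G.neighborFinset u) := by
          refine card_lt_card (ssubset_iff_of_subset sdiff_subset |>.2 ⟨x, ?_, ?_⟩)
          · simpa using hux
          · simp [hx]
        have h2 : #(G.neighborFinset u) ≤ G.maxDegree := by
          rw [SimpleGraph.card_neighborFinset_eq_degree]; exact G.degree_le_maxDegree u
        omega
    _ = _ := mul_comm _ _

/-! ### Change of density -/

/-- Two terms of the series of -log (1 - x). The quadratic one is the source of the η² in the tail.
-/
theorem one_sub_le_exp_quadratic {x : ℝ} (h0 : 0 ≤ x) (h1 : x ≤ 1) :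
    1 - x ≤ Real.exp (-x - x ^ 2 / 2) := by
  rcases h1.eq_or_lt with rfl | h1
  · simpa using (Real.exp_pos _).le
  have hs := Real.hasSum_pow_div_log_of_abs_lt_one (x := x) (by rwa [abs_of_nonneg h0])
  have h2 := sum_le_hasSum (range 2) (fun i _ => by positivity) hs
  norm_num [sum_range_succ] at h2
  rw [← Real.log_le_iff_le_exp (by linarith)]
  linarith

/-- Comparison of a cluster probability at density `p` with that at density `1 / d`. -/
theorem density_comparison {d a b : ℕ} (hd : 1 ≤ d) (hb : b ≤ (d - 1) * a) {p : ℝ} (hp : 0 ≤ p)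
    (hpd : p * d ≤ 1) :
    p ^ a * (1 - p) ^ b ≤ Real.exp (-((1 - p * d) ^ 2 / 2) * a) *
      ((1 / (d : ℝ)) ^ a * (1 - 1 / (d : ℝ)) ^ b) := by
  set η : ℝ := 1 - p * d with hη
  have hη0 : 0 ≤ η := by linarith
  have hη1 : η ≤ 1 := by
    have : 0 ≤ p * d := by positivity
    linarith
  have hd' : (1 : ℝ) ≤ d := by exact_mod_cast hd
  have hq1 : 0 ≤ 1 - 1 / (d : ℝ) := by
    rw [sub_nonneg, div_le_one (by linarith)]; exact hd'
  have hpe : p = (1 - η) * (1 / (d : ℝ)) := by rw [hη]; field_simp; ring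
  have hp1 : p ≤ 1 := by nlinarith
  have h1 : (1 - p) ^ b ≤ Real.exp (η * a) * (1 - 1 / (d : ℝ)) ^ b := by
    -- For d = 1 the boundary is empty; otherwise d - 1 may be divided by.
    rcases hd.eq_or_lt with h | h
    · have : b = 0 := by subst h; simpa using hb
      subst this
      simpa using Real.one_le_exp (by positivity : 0 ≤ η * a)
    · have hd2 : (0 : ℝ) < (d : ℝ) - 1 := by
        have : (1 : ℝ) < d := by exact_mod_cast h
        linarith
      have h2 : 1 - p = (1 + η / ((d : ℝ) - 1)) * (1 - 1 / (d : ℝ)) := by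
        rw [hpe]; field_simp; ring
      have h3 : (1 + η / ((d : ℝ) - 1)) ^ b ≤ Real.exp (η * a) := by
        calc (1 + η / ((d : ℝ) - 1)) ^ b ≤ Real.exp (η / ((d : ℝ) - 1)) ^ b := by
              gcongr
              rw [add_comm]; exact Real.add_one_le_exp _
          _ = Real.exp (b * (η / ((d : ℝ) - 1))) := (Real.exp_nat_mul _ _).symm
          _ ≤ Real.exp (η * a) := by
              rw [Real.exp_le_exp]
              have hb' : (b : ℝ) ≤ ((d : ℝ) - 1) * a := by
                have := (Nat.cast_le (α := ℝ)).2 hb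
                rwa [Nat.cast_mul, Nat.cast_sub hd, Nat.cast_one] at this
              calc (b : ℝ) * (η / ((d : ℝ) - 1))
                  ≤ (((d : ℝ) - 1) * a) * (η / ((d : ℝ) - 1)) := by gcongr
                _ = η * a := by field_simp
      rw [h2, mul_pow]
      gcongr
  have h4 : (1 - η) ^ a ≤ Real.exp (-η * a - η ^ 2 / 2 * a) := by
    calc (1 - η) ^ a ≤ Real.exp (-η - η ^ 2 / 2) ^ a :=
          pow_le_pow_left₀ (by linarith) (one_sub_le_exp_quadratic hη0 hη1) _
      _ = _ := by rw [← Real.exp_nat_mul]; ring_nf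
  calc p ^ a * (1 - p) ^ b = (1 - η) ^ a * (1 / (d : ℝ)) ^ a * (1 - p) ^ b := by
        rw [← mul_pow, ← hpe]
    _ ≤ Real.exp (-η * a - η ^ 2 / 2 * a) * (1 / (d : ℝ)) ^ a *
        (Real.exp (η * a) * (1 - 1 / (d : ℝ)) ^ b) := by
        have : 0 ≤ (1 - p) ^ b := pow_nonneg (by linarith) _
        gcongr
    _ = (Real.exp (-η * a - η ^ 2 / 2 * a) * Real.exp (η * a)) *
        ((1 / (d : ℝ)) ^ a * (1 - 1 / (d : ℝ)) ^ b) := by ring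
    _ = _ := by rw [← Real.exp_add]; ring_nf

open Classical in
/-- In subcritical independent sampling the cluster of a vertex has an exponential tail. -/
theorem sum_bernoulliWeight_cluster_le (G : SimpleGraph V) [DecidableRel G.Adj]
    (hd : 1 ≤ G.maxDegree) {p : ℝ} (hp : 0 ≤ p) (hpd : p * G.maxDegree ≤ 1) {t : ℝ} (ht : 1 ≤ t)
    (v : V) :
    ∑ S : Finset V with v ∈ S ∧ t < #(cluster G S v), bernoulliWeight p S ≤
      Real.exp (-((1 - p * G.maxDegree) ^ 2 / 2) * t) := by
  have hd' : (1 : ℝ) ≤ G.maxDegree := by exact_mod_cast hd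
  set q : ℝ := 1 / (G.maxDegree : ℝ) with hq
  have hq0 : 0 ≤ q := by positivity
  have hq1 : q ≤ 1 := by rw [hq, div_le_one (by linarith)]; exact hd'
  set ρ := Real.exp (-((1 - p * G.maxDegree) ^ 2 / 2) * t) with hρ
  set E : Finset (Finset V) := {S | v ∈ S ∧ t < #(cluster G S v)} with hE
  -- Compare the two densities on each fibre of the cluster map. Nonempty fibres are full cylinder
  -- events, since the size condition depends on K alone.
  have key : ∀ K : Finset V, ∑ S ∈ E with cluster G S v = K, bernoulliWeight p S ≤
      ρ * ∑ S ∈ E with cluster G S v = K, bernoulliWeight q S := by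
    intro K
    rcases (E.filter fun S => cluster G S v = K).eq_empty_or_nonempty with h | ⟨S, hS⟩
    · simp [h]
    simp only [hE, mem_filter, mem_univ, true_and] at hS
    obtain ⟨⟨hvS, htS⟩, rfl⟩ := hS
    have h1 : 1 < #(cluster G S v) := by
      have : (1 : ℝ) < #(cluster G S v) := lt_of_le_of_lt ht htS
      exact_mod_cast this
    have hfib : (E.filter fun T => cluster G T v = cluster G S v) =
        univ.filter fun T => T ∩ closedNeighborhood G (cluster G S v) = cluster G S v := by
      rw [← filter_cluster_eq G S v]
      ext T
      simp only [hE, mem_filter, mem_univ, true_and]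
      constructor
      · rintro ⟨⟨h, -⟩, h'⟩; exact ⟨h, h'⟩
      · rintro ⟨h, h'⟩; exact ⟨⟨h, h' ▸ htS⟩, h'⟩
    rw [hfib, sum_bernoulliWeight_cylinder _ (subset_closedNeighborhood G _),
      sum_bernoulliWeight_cylinder _ (subset_closedNeighborhood G _)]
    refine (density_comparison hd
      (card_boundary_le fun u hu => exists_adj_mem_cluster hvS h1 hu) hp hpd).trans ?_
    have hq1' : 0 ≤ 1 - q := by linarith
    refine mul_le_mul_of_nonneg_right ?_
      (mul_nonneg (pow_nonneg hq0 _) (pow_nonneg hq1' _))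
    rw [hρ, Real.exp_le_exp]
    nlinarith [sq_nonneg (1 - p * (G.maxDegree : ℝ))]
  calc ∑ S ∈ E, bernoulliWeight p S
      = ∑ K : Finset V, ∑ S ∈ E with cluster G S v = K, bernoulliWeight p S :=
        (sum_fiberwise _ _ _).symm
    _ ≤ ∑ K : Finset V, ρ * ∑ S ∈ E with cluster G S v = K, bernoulliWeight q S :=
        sum_le_sum fun K _ => key K
    _ = ρ * ∑ S ∈ E, bernoulliWeight q S := by rw [← mul_sum, sum_fiberwise]
    _ ≤ ρ * ∑ S : Finset V, bernoulliWeight q S := by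
        refine mul_le_mul_of_nonneg_left ?_ (Real.exp_pos _).le
        exact sum_le_sum_of_subset_of_nonneg (subset_univ _)
          fun S _ _ => bernoulliWeight_nonneg hq0 hq1 S
    _ = ρ := by rw [sum_bernoulliWeight, mul_one]

/-! ### The largest component of a sample -/

theorem exists_le_card_cluster (G : SimpleGraph V) {S : Finset V} (hS : S.Nonempty) :
    ∃ v ∈ S, sampledComponentSize G S ≤ #(cluster G S v) := by
  have : Nonempty (S : Set V) := hS.to_subtype
  have : Nonempty (G.induce (S : Set V)).ConnectedComponent :=
    this.map (G.induce (S : Set V)).connectedComponentMk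
  obtain ⟨c, hc⟩ := exists_eq_ciSup_of_finite
    (f := fun c : (G.induce (S : Set V)).ConnectedComponent => c.supp.ncard)
  induction c using SimpleGraph.ConnectedComponent.ind with
  | h v =>
    refine ⟨v, v.2, ?_⟩
    rw [sampledComponentSize, largestComponentSize, ← hc,
      ← Set.ncard_image_of_injective _ Subtype.val_injective, ← Set.ncard_coe_finset]
    refine Set.ncard_le_ncard ?_ (finite_toSet _)
    rintro _ ⟨u, hu, rfl⟩
    rw [SimpleGraph.ConnectedComponent.mem_supp_iff, SimpleGraph.ConnectedComponent.eq] at hu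
    have hvu := (SimpleGraph.reachable_iff_reflTransGen _ _).1 hu.symm
    exact mem_cluster.2 (hvu.lift Subtype.val fun a b hab => ⟨hab, b.2⟩)

theorem sampledComponentSize_le_card (G : SimpleGraph V) (S : Finset V) :
    sampledComponentSize G S ≤ #S := by
  rcases S.eq_empty_or_nonempty with rfl | hS
  · have : IsEmpty ((∅ : Finset V) : Set V) := by simp
    have : IsEmpty (G.induce ((∅ : Finset V) : Set V)).ConnectedComponent :=
      ⟨fun c => c.ind fun v => isEmptyElim v⟩
    simp [sampledComponentSize, largestComponentSize]
  · obtain ⟨v, hv, h⟩ := exists_le_card_cluster G hS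
    exact h.trans (card_le_card (cluster_subset hv))

/-- Covers the case of large Δ, where rounding B could spoil subcriticality but B is below the
threshold. -/
theorem sampleProb_eq_zero_of_card_le (G : SimpleGraph V) {B : ℕ} {t : ℝ} (h : (B : ℝ) ≤ t) :
    sampleProb V B (fun S => t < sampledComponentSize G S) = 0 := by
  rw [sampleProb, filter_false_of_mem]
  · simp
  · intro S hS
    have h1 : (sampledComponentSize G S : ℝ) ≤ B := by
      rw [← (mem_powersetCard.1 hS).2]
      exact_mod_cast sampledComponentSize_le_card G S
    exact not_lt.2 (h1.trans h)

theorem sampleProb_component_le (G : SimpleGraph V) [DecidableRel G.Adj] (hd : 1 ≤ G.maxDegree)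
    [Nonempty V] {B : ℕ} (hB : (B : ℝ) * G.maxDegree ≤ Fintype.card V) {t : ℝ} (ht : 1 ≤ t) :
    sampleProb V B (fun S => t < sampledComponentSize G S) ≤
      ((Fintype.card V : ℝ) + 1) * (Fintype.card V *
        Real.exp (-((1 - (B : ℝ) / Fintype.card V * G.maxDegree) ^ 2 / 2) * t)) := by
  classical
  have hd' : (1 : ℝ) ≤ G.maxDegree := by exact_mod_cast hd
  have hn' : (0 : ℝ) < Fintype.card V := by exact_mod_cast Fintype.card_pos
  have hBn : B ≤ Fintype.card V := by
    have : (B : ℝ) ≤ Fintype.card V := (le_mul_of_one_le_right (by positivity) hd').trans hB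
    exact_mod_cast this
  set p : ℝ := (B : ℝ) / Fintype.card V with hp
  have hp0 : 0 ≤ p := by positivity
  have hp1 : p ≤ 1 := by rw [hp, div_le_one hn']; exact_mod_cast hBn
  have hpd : p * G.maxDegree ≤ 1 := by
    rw [hp, div_mul_eq_mul_div, div_le_one hn']; exact hB
  refine (sampleProb_le_bernoulli hBn _).trans ?_
  refine mul_le_mul_of_nonneg_left ?_ (by positivity)
  calc ∑ S : Finset V with t < sampledComponentSize G S, bernoulliWeight p S
      ≤ ∑ S : Finset V, ∑ v : V,
          if v ∈ S ∧ t < #(cluster G S v) then bernoulliWeight p S else 0 := by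
        rw [sum_filter]
        refine sum_le_sum fun S _ => ?_
        have hnn : ∀ v ∈ (univ : Finset V),
            0 ≤ if v ∈ S ∧ t < #(cluster G S v) then bernoulliWeight p S else 0 := by
          intro v _
          split_ifs
          exacts [bernoulliWeight_nonneg hp0 hp1 S, le_rfl]
        split_ifs with hS
        · have hne : S.Nonempty := by
            rw [← card_pos]
            have h0 : (0 : ℝ) < sampledComponentSize G S := by linarith
            exact lt_of_lt_of_le (by exact_mod_cast h0) (sampledComponentSize_le_card G S)
          obtain ⟨v, hv, h⟩ := exists_le_card_cluster G hne
          refine le_trans ?_ (single_le_sum hnn (mem_univ v))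
          rw [if_pos ⟨hv, hS.trans_le (by exact_mod_cast h)⟩]
        · exact sum_nonneg hnn
    _ = ∑ v : V, ∑ S : Finset V with v ∈ S ∧ t < #(cluster G S v), bernoulliWeight p S := by
        rw [sum_comm]
        exact sum_congr rfl fun v _ => (sum_filter _ _).symm
    _ ≤ ∑ _v : V, Real.exp (-((1 - p * G.maxDegree) ^ 2 / 2) * t) :=
        sum_le_sum fun v _ => sum_bernoulliWeight_cluster_le G hd hp0 hpd ht v
    _ = _ := by simp

/-- If the sampling density times the maximum degree is at most `1 - η`, components larger than
`2 (k + 3) log n / η ^ 2` occur with probability at most `n ^ (-k)`. -/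
theorem sampleProb_component_le_pow (k : ℕ) (G : SimpleGraph V) [DecidableRel G.Adj]
    (hd : 1 ≤ G.maxDegree) {η : ℝ} (hη : 0 < η) {B : ℕ}
    (hB : (B : ℝ) * G.maxDegree ≤ (1 - η) * Fintype.card V) {t : ℝ}
    (ht : 2 * (k + 3) * Real.log (Fintype.card V) / η ^ 2 ≤ t) (hn : 2 ≤ Fintype.card V) :
    sampleProb V B (fun S => t < sampledComponentSize G S) ≤ 1 / (Fintype.card V : ℝ) ^ k := by
  have : Nonempty V := Fintype.card_pos_iff.1 (by omega)
  set n := Fintype.card V with hn_def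
  have hn2 : (2 : ℝ) ≤ n := by exact_mod_cast hn
  have hn' : (0 : ℝ) < n := by linarith
  have hη1 : η ≤ 1 := by
    by_contra! h
    have : (0 : ℝ) ≤ (B : ℝ) * G.maxDegree := by positivity
    nlinarith
  have hlog : (1 : ℝ) / 2 ≤ Real.log n := by
    have := Real.log_le_log (by norm_num) hn2
    linarith [Real.log_two_gt_d9]
  have hk : (0 : ℝ) ≤ k := by positivity
  have ht' : 2 * (k + 3) * Real.log n ≤ t * η ^ 2 := by
    rwa [div_le_iff₀ (by positivity)] at ht
  have ht1 : 1 ≤ t := by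
    have h1 : 1 ≤ 2 * (k + 3) * Real.log n := by nlinarith
    have h2 : η ^ 2 ≤ 1 := by nlinarith
    by_contra! h
    have := sq_nonneg η
    rcases le_or_gt t 0 with h0 | h0 <;> nlinarith
  have hpη : η ≤ 1 - (B : ℝ) / n * G.maxDegree := by
    have : (B : ℝ) / n * G.maxDegree ≤ 1 - η := by
      rw [div_mul_eq_mul_div, div_le_iff₀ hn']; exact hB
    linarith
  refine (sampleProb_component_le G hd (hB.trans (by nlinarith)) ht1).trans ?_
  -- The exponent k + 3 pays for the prefactor (n + 1) n ≤ n³, valid as n ≥ 2.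
  have hexp : Real.exp (-((1 - (B : ℝ) / n * G.maxDegree) ^ 2 / 2) * t) ≤
      1 / (n : ℝ) ^ (k + 3) := by
    rw [one_div, ← Real.exp_log (pow_pos hn' (k + 3)), ← Real.exp_neg, Real.exp_le_exp,
      Real.log_pow]
    push_cast
    have h1 : η ^ 2 ≤ (1 - (B : ℝ) / n * G.maxDegree) ^ 2 := by gcongr
    nlinarith
  calc ((n : ℝ) + 1) * (n * Real.exp (-((1 - (B : ℝ) / n * G.maxDegree) ^ 2 / 2) * t))
      ≤ (n : ℝ) ^ 2 * (n * (1 / (n : ℝ) ^ (k + 3))) := by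
        gcongr
        nlinarith
    _ = 1 / (n : ℝ) ^ k := by
        field_simp
        ring

theorem maxDegree_lt_card_of_one_le (G : SimpleGraph V) [DecidableRel G.Adj]
    (hd : 1 ≤ G.maxDegree) : G.maxDegree < Fintype.card V := by
  have : Nonempty V := by
    by_contra h
    rw [not_nonempty_iff] at h
    simp at hd
  exact G.maxDegree_lt_card_verts

end SubgraphSampling

theorem corollaryA1 (k : ℕ) :
    -- sampling `ε n / Δ` vertices, with `ε` bounded away from `1`
    (∀ ε₀ : ℝ, ε₀ < 1 → ∃ C : ℝ, 0 < C ∧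
      ∀ (V : Type) [Fintype V] (G : SimpleGraph V) [DecidableRel G.Adj], 1 ≤ G.maxDegree →
      ∀ ε : ℝ, 0 < ε → ε ≤ ε₀ →
      ∀ B : ℕ, |(B : ℝ) - ε * (Fintype.card V / G.maxDegree)| < 1 →
        SubgraphSampling.sampleProb V B (fun S =>
            C * (Real.log (Fintype.card V) / ε ^ 2) < SubgraphSampling.sampledComponentSize G S)
          ≤ 1 / (Fintype.card V : ℝ) ^ k) ∧
    -- sampling `(1 - ε) n / Δ` vertices, with an absolute constant
    (∃ C : ℝ, 0 < C ∧
      ∀ (V : Type) [Fintype V] (G : SimpleGraph V) [DecidableRel G.Adj], 1 ≤ G.maxDegree →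
      ∀ ε : ℝ, 0 < ε → ε < 1 →
      ∀ B : ℕ, |(B : ℝ) - (1 - ε) * (Fintype.card V / G.maxDegree)| < 1 →
        SubgraphSampling.sampleProb V B (fun S =>
            C * (Real.log (Fintype.card V) / ε ^ 2) < SubgraphSampling.sampledComponentSize G S)
          ≤ 1 / (Fintype.card V : ℝ) ^ k) := by
  have hk : (0 : ℝ) ≤ k := by positivity
  constructor
  · intro ε₀ hε₀
    obtain ⟨δ, hδ⟩ : ∃ δ, δ = 1 - ε₀ := ⟨_, rfl⟩
    have hδ0 : 0 < δ := by linarith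
    refine ⟨8 * (k + 3) / δ ^ 2, by positivity, ?_⟩
    intro V _ G _ hd ε hε hεε₀ B hB
    have hlt := SubgraphSampling.maxDegree_lt_card_of_one_le G hd
    have hn2 : (2 : ℝ) ≤ Fintype.card V := by exact_mod_cast (by omega : 2 ≤ Fintype.card V)
    have hd0 : (0 : ℝ) < G.maxDegree := by exact_mod_cast hd
    have hlog : (1 : ℝ) / 2 ≤ Real.log (Fintype.card V) := by
      have := Real.log_le_log (by norm_num) hn2
      linarith [Real.log_two_gt_d9]
    have hε1 : ε ^ 2 ≤ 1 := by nlinarith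
    have hlogε : Real.log (Fintype.card V) ≤ Real.log (Fintype.card V) / ε ^ 2 := by
      rw [le_div_iff₀ (by positivity)]
      nlinarith
    have hB' : (B : ℝ) < ε * (Fintype.card V / G.maxDegree) + 1 := by
      linarith [(abs_lt.1 hB).2]
    -- Rounding adds at most Δ to BΔ. Either half of the gap δ absorbs this, or n/Δ < 2/δ and B is
    -- bounded by a constant.
    rcases le_or_gt ((G.maxDegree : ℝ)) (δ / 2 * Fintype.card V) with h | h
    · refine SubgraphSampling.sampleProb_component_le_pow k G hd (η := δ / 2) (by positivity)
        ?_ ?_ (by omega)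
      · have h1 : (B : ℝ) * G.maxDegree ≤
            (ε * (Fintype.card V / G.maxDegree) + 1) * G.maxDegree := by gcongr
        have h2 : (ε * ((Fintype.card V : ℝ) / G.maxDegree) + 1) * G.maxDegree =
            ε * Fintype.card V + G.maxDegree := by field_simp
        nlinarith
      · calc 2 * (k + 3) * Real.log (Fintype.card V) / (δ / 2) ^ 2
            = 8 * (k + 3) / δ ^ 2 * Real.log (Fintype.card V) := by field_simp; ring
          _ ≤ _ := by gcongr
    · rw [SubgraphSampling.sampleProb_eq_zero_of_card_le]
      · positivity
      have hδ1 : δ < 1 := by linarith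
      have h1 : (Fintype.card V : ℝ) / G.maxDegree ≤ 2 / δ := by
        rw [div_le_div_iff₀ hd0 hδ0]
        linarith
      have h2 : (B : ℝ) ≤ 3 / δ := by
        have h3 : ε * ((Fintype.card V : ℝ) / G.maxDegree) ≤ 1 * (2 / δ) := by
          gcongr
          linarith
        have h4 : 1 ≤ 1 / δ := by rw [le_div_iff₀ hδ0]; linarith
        have h5 : 3 / δ = 2 / δ + 1 / δ := by ring
        linarith
      calc (B : ℝ) ≤ 3 / δ := h2
        _ ≤ 3 / δ ^ 2 := by
            gcongr
            nlinarith
        _ ≤ 8 * (k + 3) / δ ^ 2 * (1 / 2) := by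
            rw [div_mul_eq_mul_div]
            gcongr
            linarith
        _ ≤ _ := by
            exact mul_le_mul_of_nonneg_left (hlog.trans hlogε) (by positivity)
  · refine ⟨8 * (k + 3), by positivity, ?_⟩
    intro V _ G _ hd ε hε hε1 B hB
    have hlt := SubgraphSampling.maxDegree_lt_card_of_one_le G hd
    have hn2 : (2 : ℝ) ≤ Fintype.card V := by exact_mod_cast (by omega : 2 ≤ Fintype.card V)
    have hd0 : (0 : ℝ) < G.maxDegree := by exact_mod_cast hd
    have hlog : (1 : ℝ) / 2 ≤ Real.log (Fintype.card V) := by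
      have := Real.log_le_log (by norm_num) hn2
      linarith [Real.log_two_gt_d9]
    have hB' : (B : ℝ) < (1 - ε) * (Fintype.card V / G.maxDegree) + 1 := by
      linarith [(abs_lt.1 hB).2]
    -- The gap is now ε itself; halving it turns the factor 2 into 8. Otherwise n/Δ < 2/ε, so B is
    -- O(1/ε), below the threshold.
    rcases le_or_gt ((G.maxDegree : ℝ)) (ε / 2 * Fintype.card V) with h | h
    · refine SubgraphSampling.sampleProb_component_le_pow k G hd (η := ε / 2) (by positivity)
        ?_ (le_of_eq ?_) (by omega)
      · have h1 : (B : ℝ) * G.maxDegree ≤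
            ((1 - ε) * (Fintype.card V / G.maxDegree) + 1) * G.maxDegree := by gcongr
        have h2 : ((1 - ε) * ((Fintype.card V : ℝ) / G.maxDegree) + 1) * G.maxDegree =
            (1 - ε) * Fintype.card V + G.maxDegree := by field_simp
        nlinarith
      · field_simp; ring
    · rw [SubgraphSampling.sampleProb_eq_zero_of_card_le]
      · positivity
      obtain ⟨x, hx⟩ : ∃ x, x = (Fintype.card V : ℝ) / G.maxDegree := ⟨_, rfl⟩
      rw [← hx] at hB'
      have hx1 : 1 ≤ x := by
        rw [hx, le_div_iff₀ hd0]
        exact_mod_cast (by omega : 1 * G.maxDegree ≤ Fintype.card V)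
      have hxε : x * ε ≤ 2 := by
        rw [hx, div_mul_eq_mul_div, div_le_iff₀ hd0]
        linarith
      have h2 : (B : ℝ) ≤ 2 * x := by nlinarith
      rw [← mul_div_assoc, le_div_iff₀ (by positivity)]
      have h3 : (x * ε) * ε ≤ 2 * 1 := by gcongr
      calc (B : ℝ) * ε ^ 2 ≤ 2 * x * ε ^ 2 := by gcongr
        _ ≤ 8 * 3 * (1 / 2) := by nlinarith
        _ ≤ 8 * (k + 3) * Real.log (Fintype.card V) := by
            gcongr
            linarith
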